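/- **Partial-computing red-blue pebble game (PRBP).** Let $G=(V,E)$ be a finite DAG and $r\ge 1$ an integer (the fast memory capacity). In every state of the game each node carries no pebble, or a blue pebble, or a blue and a light red pebble, or only a dark red pebble, and each edge is either marked or unmarked. Initially exactly the sources carry a blue pebble, there are no other pebbles, and no edge is marked. The moves are: (1) *save*: replace a dark red pebble on a node $v$ by a blue and a light red pebble; (2) *load*: place a light red pebble on a node $v$ that has a blue pebble; (3) *partial compute*: for an unmarked edge $(u,v)$ such that all incoming edges of $u$ are marked, $u$ has a (light or dark) red pebble, and $v$ has either a (light or dark) red pebble or no pebble at all, replace all pebbles on $v$ by a dark red pebble and mark $(u,v)$; (4) *delete*: remove a light red pebble from a node $v$, or remove a dark red pebble from a node $v$ all of whose incoming and outgoing edges are marked. A pebbling strategy is a finite sequence of moves from the initial state, with at most $r$ (light and dark) red pebbles on $G$ at any time, to a state in which every edge is marked and every sink has a blue pebble. Its cost is its number of save and load moves, and $\mathrm{OPT}_{PRBP}(G,r)$ is the minimum cost of a pebbling strategy ($+\infty$ if there is none). **Matrix multiplication DAG.** For integers $m_1,m_2,m_3\ge 1$, let $G_{m_1,m_2,m_3}$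 be the DAG of the standard multiplication of an $m_1\times m_2$ matrix $A$ by an $m_2\times m_3$ matrix $B$. Its nodes are the sources $A_{i,k}$ and $B_{k,j}$, the internal nodes $P_{i,k,j}$, and the sinks $C_{i,j}$ ($1\le i\le m_1$, $1\le k\le m_2$, $1\le j\le m_3$), and its edges are $A_{i,k}\to P_{i,k,j}$, $B_{k,j}\to P_{i,k,j}$ and $P_{i,k,j}\to C_{i,j}$ for all $i,k,j$. **Theorem.** $\mathrm{OPT}_{PRBP}(G_{m_1,m_2,m_3},r)=\Omega\left(\frac{m_1 m_2 m_3}{\sqrt r}\right)$; that is, there is an absolute constant $c>0$ such that for all integers $m_1,m_2,m_3\ge 1$ and $r\ge 1$, $$\mathrm{OPT}_{PRBP}(G_{m_1,m_2,m_3},r)\ \ge\ c\cdot\frac{m_1 m_2 m_3}{\sqrt r}.$$ -/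

import Mathlib

/-- A directed acyclic graph on the node set `V`. -/
structure DAG (V : Type*) where
  /-- `Edge u v` means that there is a directed edge from `u` to `v`. -/
  Edge : V → V → Prop
  acyclic : ∀ v, ¬ Relation.TransGen Edge v v

namespace DAG

/-- A source: a node without incoming edges. -/
def IsSource {V : Type*} (G : DAG V) (v : V) : Prop := ∀ u, ¬ G.Edge u v

/-- A sink: a node without outgoing edges. -/
def IsSink {V : Type*} (G : DAG V) (v : V) : Prop := ∀ w, ¬ G.Edge v w

end DAG

namespace PRBP

/-- The four possible sets of pebbles on a node in the partial-computing red-blue pebble game. -/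
inductive Pebbles where
  /-- no pebble -/
  | empty
  /-- a blue pebble only -/
  | blue
  /-- a blue and a light red pebble -/
  | blueLight
  /-- a dark red pebble only -/
  | dark

/-- There is a (light or dark) red pebble. -/
def Pebbles.HasRed (p : Pebbles) : Prop := p = .blueLight ∨ p = .dark

/-- There is a blue pebble. -/
def Pebbles.HasBlue (p : Pebbles) : Prop := p = .blue ∨ p = .blueLight

/-- A state of the game: the pebbles on each node and the set of marked edges. -/
structure Config (V : Type*) where
  pebbles : V → Pebbles
  marked : Set (V × V)

/-- The moves of the game. -/
inductive Move (V : Type*) where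
  | save (v : V)
  | load (v : V)
  /-- partial compute along the edge `(u, v)` -/
  | compute (u v : V)
  | delete (v : V)

/-- Save and load operations cost `1`, partial compute and delete operations are free. -/
def Move.cost {V : Type*} : Move V → ℕ
  | .save _ => 1
  | .load _ => 1
  | .compute _ _ => 0
  | .delete _ => 0

/-- All incoming edges of `v` are marked. -/
def Config.InMarked {V : Type*} (c : Config V) (G : DAG V) (v : V) : Prop :=
  ∀ u, G.Edge u v → (u, v) ∈ c.marked

/-- All outgoing edges of `v` are marked. -/
def Config.OutMarked {V : Type*} (c : Config V) (G : DAG V) (v : V) : Prop :=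
  ∀ w, G.Edge v w → (v, w) ∈ c.marked

/-- The number of (light and dark) red pebbles on the DAG. -/
noncomputable def Config.redCount {V : Type*} (c : Config V) : ℕ∞ :=
  {v | (c.pebbles v).HasRed}.encard

open Classical in
/-- The state in which the pebbles on `v` have been replaced by `p`. -/
noncomputable def Config.setPebbles {V : Type*} (c : Config V) (v : V) (p : Pebbles) :
    Config V where
  pebbles := Function.update c.pebbles v p
  marked := c.marked

/-- The transition rules: `Step G c m c'` says that the move `m` is allowed in the state `c` and
leads to the state `c'` (the memory capacity is not part of this relation).

A dark red pebble may be deleted from `v` only if the value of `v` is fully computed and is not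
needed as an input any more. For a node that has outgoing edges the first condition follows from
the second one in every reachable state; for a sink it rules out that a partially computed value
is thrown away and the computation is continued afterwards. -/
inductive Step {V : Type*} (G : DAG V) : Config V → Move V → Config V → Prop where
  | save (c : Config V) (v : V) (h : c.pebbles v = .dark) :
      Step G c (.save v) (c.setPebbles v .blueLight)
  | load (c : Config V) (v : V) (h : (c.pebbles v).HasBlue) :
      Step G c (.load v) (c.setPebbles v .blueLight)
  | compute (c : Config V) (u v : V) (hedge : G.Edge u v) (hunmarked : (u, v) ∉ c.marked)
      (hin : c.InMarked G u) (hu : (c.pebbles u).HasRed)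
      (hv : (c.pebbles v).HasRed ∨ c.pebbles v = .empty) :
      Step G c (.compute u v)
        { pebbles := (c.setPebbles v .dark).pebbles, marked := insert (u, v) c.marked }
  | deleteLight (c : Config V) (v : V) (h : c.pebbles v = .blueLight) :
      Step G c (.delete v) (c.setPebbles v .blue)
  | deleteDark (c : Config V) (v : V) (h : c.pebbles v = .dark)
      (hin : c.InMarked G v) (hout : c.OutMarked G v) :
      Step G c (.delete v) (c.setPebbles v .empty)

open Classical in
/-- The initial state: blue pebbles on exactly the sources, no marked edges. -/
noncomputable def initial {V : Type*} (G : DAG V) : Config V where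
  pebbles := fun v => if G.IsSource v then .blue else .empty
  marked := ∅

/-- A terminal state: every sink has a blue pebble and every edge is marked. -/
def IsTerminal {V : Type*} (G : DAG V) (c : Config V) : Prop :=
  (∀ v, G.IsSink v → (c.pebbles v).HasBlue) ∧ ∀ u v, G.Edge u v → (u, v) ∈ c.marked

/-- A (one-shot) pebbling strategy with at most `r` red pebbles: `length` moves, the `t`-th of
which leads from the state `config t` to `config (t + 1)`. The values of `config` beyond `length`
and of `move` from `length` on are irrelevant. -/
structure Pebbling {V : Type*} (G : DAG V) (r : ℕ) where
  length : ℕ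
  config : ℕ → Config V
  move : ℕ → Move V
  start : config 0 = initial G
  step : ∀ t < length, Step G (config t) (move t) (config (t + 1))
  capacity : ∀ t ≤ length, (config t).redCount ≤ r
  terminal : IsTerminal G (config length)

/-- The cost of a pebbling strategy: its number of save and load operations. -/
def Pebbling.cost {V : Type*} {G : DAG V} {r : ℕ} (P : Pebbling G r) : ℕ :=
  ∑ t ∈ Finset.range P.length, (P.move t).cost

/-- The optimal cost of a pebbling strategy with at most `r` red pebbles
(`⊤` if there is no such strategy). -/
noncomputable def OPT {V : Type*} (G : DAG V) (r : ℕ) : ℕ∞ :=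
  ⨅ P : Pebbling G r, (P.cost : ℕ∞)

end PRBP

/-- The nodes of the DAG of standard matrix multiplication `C = A * B`, where `A` has size
`m₁ × m₂` and `B` has size `m₂ × m₃`. -/
inductive MatMulNode (m₁ m₂ m₃ : ℕ) where
  /-- the input `A i k` -/
  | left (i : Fin m₁) (k : Fin m₂)
  /-- the input `B k j` -/
  | right (k : Fin m₂) (j : Fin m₃)
  /-- the product `A i k * B k j` -/
  | prod (i : Fin m₁) (k : Fin m₂) (j : Fin m₃)
  /-- the output `C i j`, the sum of the products `A i k * B k j` over all `k` -/
  | out (i : Fin m₁) (j : Fin m₃)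

/-- The edges of the matrix multiplication DAG. -/
inductive MatMulEdge (m₁ m₂ m₃ : ℕ) : MatMulNode m₁ m₂ m₃ → MatMulNode m₁ m₂ m₃ → Prop where
  | left (i : Fin m₁) (k : Fin m₂) (j : Fin m₃) : MatMulEdge m₁ m₂ m₃ (.left i k) (.prod i k j)
  | right (i : Fin m₁) (k : Fin m₂) (j : Fin m₃) : MatMulEdge m₁ m₂ m₃ (.right k j) (.prod i k j)
  | out (i : Fin m₁) (k : Fin m₂) (j : Fin m₃) : MatMulEdge m₁ m₂ m₃ (.prod i k j) (.out i j)

/-- The layer of a node; it witnesses acyclicity. -/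
def MatMulNode.layer {m₁ m₂ m₃ : ℕ} : MatMulNode m₁ m₂ m₃ → ℕ
  | .left _ _ => 0
  | .right _ _ => 0
  | .prod _ _ _ => 1
  | .out _ _ => 2

theorem MatMulEdge.layer_lt {m₁ m₂ m₃ : ℕ} {u v : MatMulNode m₁ m₂ m₃}
    (h : MatMulEdge m₁ m₂ m₃ u v) : u.layer < v.layer := by
  cases h <;> simp [MatMulNode.layer]

theorem MatMulEdge.layer_lt_of_transGen {m₁ m₂ m₃ : ℕ} {u v : MatMulNode m₁ m₂ m₃}
    (h : Relation.TransGen (MatMulEdge m₁ m₂ m₃) u v) : u.layer < v.layer := by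
  induction h with
  | single h => exact h.layer_lt
  | tail _ h ih => exact ih.trans h.layer_lt

/-- The DAG of standard matrix multiplication of an `m₁ × m₂` matrix by an `m₂ × m₃` matrix. -/
def matMulDAG (m₁ m₂ m₃ : ℕ) : DAG (MatMulNode m₁ m₂ m₃) where
  Edge := MatMulEdge m₁ m₂ m₃
  acyclic := fun _ h => lt_irrefl _ (MatMulEdge.layer_lt_of_transGen h)

/-! Cut the strategy into segments of cost `r`. In a segment with `a` red pebbles at its start and
cost `q`, a product added to its output was red at the start or loaded, which covers at most `a + q`
products, or was computed from scratch inside the segment. In the latter case `A i k` and `B k j`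
were red at the start or loaded, and `C i j`, being dark red after the addition, is red at the end
or was saved. Loomis–Whitney bounds these triples by `(a + q) * √(r + q)`, so a segment adds `O(r *
√r)` products (`card_added_le`). Since the game starts without red pebbles, an initial segment of
cost `q ≤ r` adds only `O(q * √r)`, so summing leaves no additive loss (`card_added_le_costUpTo`).
-/

namespace PRBP

/-! ### Effect of a single move. -/

variable {V : Type*} {G : DAG V}

theorem Step.marked_subset {c c' : Config V} {m : Move V} (h : Step G c m c') :
    c.marked ⊆ c'.marked := by
  cases h with
  | compute => exact Set.subset_insert _ _
  | _ => exact subset_rfl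

/-- A node that loses its last pebble after receiving a partial value is fully processed. -/
theorem Step.processed {c c' : Config V} {m : Move V} (h : Step G c m c')
    (hc : ∀ u v, (u, v) ∈ c.marked → c.pebbles v = .empty → c.InMarked G v ∧ c.OutMarked G v)
    (u v : V) (huv : (u, v) ∈ c'.marked) (hv : c'.pebbles v = .empty) :
    c'.InMarked G v ∧ c'.OutMarked G v := by
  cases h with
  | compute x y =>
    by_cases hxy : v = y
    · subst hxy
      simp [Config.setPebbles] at hv
    · have hv' : c.pebbles v = .empty := by simpa [Config.setPebbles, hxy] using hv
      have huv' : (u, v) ∈ c.marked := by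
        rcases huv with h | h
        · exact absurd (Prod.ext_iff.1 h).2 hxy
        · exact h
      obtain ⟨h₁, h₂⟩ := hc u v huv' hv'
      exact ⟨fun w hw => .inr (h₁ w hw), fun w hw => .inr (h₂ w hw)⟩
  | deleteDark w h hin hout =>
    by_cases hw : v = w
    · subst hw
      exact ⟨hin, hout⟩
    · exact hc u v huv (by simpa [Config.setPebbles, hw] using hv)
  | save w h | load w h | deleteLight w h =>
    by_cases hw : v = w
    · subst hw
      simp [Config.setPebbles] at hv
    · exact hc u v huv (by simpa [Config.setPebbles, hw] using hv)

/-- A red pebble appears by a load, or by a partial compute on an empty node. -/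
theorem Step.hasRed {c c' : Config V} {m : Move V} (h : Step G c m c') {v : V}
    (hv : (c'.pebbles v).HasRed) :
    (c.pebbles v).HasRed ∨ m = .load v ∨ (c.pebbles v = .empty ∧ ∃ u, G.Edge u v) := by
  cases h with
  | compute x y hedge _ _ _ hy =>
    by_cases hxy : v = y
    · subst hxy
      exact hy.imp_right fun h => .inr ⟨h, x, hedge⟩
    · exact .inl (by simpa [Config.setPebbles, hxy] using hv)
  | load w h =>
    by_cases hw : v = w
    · exact .inr (.inl (by rw [hw]))
    · exact .inl (by simpa [Config.setPebbles, hw] using hv)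
  | save w h =>
    by_cases hw : v = w
    · exact .inl (by rw [hw, h]; exact .inr rfl)
    · exact .inl (by simpa [Config.setPebbles, hw] using hv)
  | deleteLight w h | deleteDark w h =>
    by_cases hw : v = w
    · subst hw
      simp [Config.setPebbles, Pebbles.HasRed] at hv
    · exact .inl (by simpa [Config.setPebbles, hw] using hv)

/-- A newly marked edge is marked by a partial compute. -/
theorem Step.of_marked {c c' : Config V} {m : Move V} (h : Step G c m c') {u v : V}
    (hc : (u, v) ∉ c.marked) (hc' : (u, v) ∈ c'.marked) :
    (c.pebbles u).HasRed ∧ c.InMarked G u ∧ c'.pebbles v = .dark := by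
  cases h with
  | compute x y hedge hun hin hx hy =>
    rcases hc' with h | h
    · obtain ⟨rfl, rfl⟩ := Prod.ext_iff.1 h
      exact ⟨hx, hin, by simp [Config.setPebbles]⟩
    · exact absurd h hc
  | _ => exact absurd hc' hc

/-- A dark red pebble disappears by a save, or by a deletion after which all incoming edges are
marked. -/
theorem Step.dark {c c' : Config V} {m : Move V} (h : Step G c m c') {v : V}
    (hv : c.pebbles v = .dark) :
    c'.pebbles v = .dark ∨ m = .save v ∨ (c'.pebbles v = .empty ∧ c'.InMarked G v) := by
  cases h with
  | compute x y => by_cases hxy : v = y <;> simp [Config.setPebbles, hxy, hv]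
  | save w h => by_cases hw : v = w <;> simp [Config.setPebbles, hw, hv]
  | load w h =>
    by_cases hw : v = w
    · subst hw
      simp [hv, Pebbles.HasBlue] at h
    · simp [Config.setPebbles, hw, hv]
  | deleteLight w h =>
    by_cases hw : v = w
    · subst hw
      simp [hv] at h
    · simp [Config.setPebbles, hw, hv]
  | deleteDark w h hin =>
    by_cases hw : v = w
    · subst hw
      exact .inr (.inr ⟨by simp [Config.setPebbles], hin⟩)
    · simp [Config.setPebbles, hw, hv]

/-- A node without pebbles all of whose incoming edges are marked stays without pebbles. -/
theorem Step.dead {c c' : Config V} {m : Move V} (h : Step G c m c') {v : V}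
    (hv : c.pebbles v = .empty) (hin : c.InMarked G v) :
    c'.pebbles v = .empty ∧ c'.InMarked G v := by
  refine ⟨?_, fun u hu => h.marked_subset (hin u hu)⟩
  cases h with
  | compute x y hedge hun =>
    by_cases hxy : v = y
    · subst hxy
      exact absurd (hin x hedge) hun
    · simpa [Config.setPebbles, hxy] using hv
  | save w h | load w h | deleteLight w h | deleteDark w h =>
    by_cases hw : v = w
    · subst hw
      simp [hv, Pebbles.HasBlue] at h
    · simpa [Config.setPebbles, hw] using hv

/-! ### Time intervals of a strategy on an arbitrary DAG. -/

namespace Pebbling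

variable {r : ℕ} (P : Pebbling G r)

/-- The cost of the first `t` moves. -/
def costUpTo (t : ℕ) : ℕ := ∑ u ∈ Finset.range t, (P.move u).cost

theorem costUpTo_succ (t : ℕ) : P.costUpTo (t + 1) = P.costUpTo t + (P.move t).cost :=
  Finset.sum_range_succ _ _

theorem costUpTo_mono : Monotone P.costUpTo :=
  monotone_nat_of_le_succ fun t => by simp [costUpTo_succ]

theorem costUpTo_succ_le (t : ℕ) : P.costUpTo (t + 1) ≤ P.costUpTo t + 1 := by
  rw [costUpTo_succ]
  cases P.move t <;> simp [Move.cost]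

/-- The cost grows by at most one per move, so it skips no value; this allows cutting off a segment
of cost exactly `r`. -/
theorem exists_costUpTo_eq {n t : ℕ} (h : n ≤ P.costUpTo t) : ∃ s ≤ t, P.costUpTo s = n := by
  induction t with
  | zero => exact ⟨0, le_rfl, by simp_all [costUpTo]⟩
  | succ t ih =>
    by_cases hn : n ≤ P.costUpTo t
    · obtain ⟨s, hs, h⟩ := ih hn
      exact ⟨s, hs.trans t.le_succ, h⟩
    · have := P.costUpTo_succ_le t
      exact ⟨t + 1, le_rfl, by omega⟩

/-- The nodes loaded or saved in a time interval are at most as many as its cost. -/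
theorem exists_transferred {s t : ℕ} (hst : s ≤ t) :
    ∃ S : Finset V, P.costUpTo s + S.card ≤ P.costUpTo t ∧
      ∀ u, s ≤ u → u < t → ∀ v, P.move u = .load v ∨ P.move u = .save v → v ∈ S := by
  classical
  induction t, hst using Nat.le_induction with
  | base => exact ⟨∅, by simp, fun u h₁ h₂ => by omega⟩
  | succ t hst ih =>
    obtain ⟨S, hS, h⟩ := ih
    have key : ∀ x, (P.move t = .load x ∨ P.move t = .save x) →
        ∃ S : Finset V, P.costUpTo s + S.card ≤ P.costUpTo (t + 1) ∧
      ∀ u, s ≤ u → u < t + 1 → ∀ v, P.move u = .load v ∨ P.move u = .save v → v ∈ S := by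
      intro x hx
      refine ⟨insert x S, ?_, fun u h₁ h₂ v hv => ?_⟩
      · have := Finset.card_insert_le x S
        have : (P.move t).cost = 1 := by rcases hx with h | h <;> simp [h, Move.cost]
        rw [costUpTo_succ]
        omega
      · rcases Nat.lt_succ_iff_lt_or_eq.1 h₂ with h₂ | rfl
        · exact Finset.mem_insert_of_mem (h u h₁ h₂ v hv)
        · have : v = x := by rcases hx with h | h <;> rcases hv with h' | h' <;> simp_all
          simp [this]
    by_cases hx : ∃ x, P.move t = .load x ∨ P.move t = .save x
    · exact key _ hx.choose_spec
    · refine ⟨S, hS.trans (P.costUpTo_mono t.le_succ), fun u h₁ h₂ v hv => ?_⟩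
      rcases Nat.lt_succ_iff_lt_or_eq.1 h₂ with h₂ | rfl
      · exact h u h₁ h₂ v hv
      · exact absurd ⟨v, hv⟩ hx

theorem exists_red {t : ℕ} (ht : t ≤ P.length) :
    ∃ S : Finset V, S.card ≤ r ∧ ∀ v, ((P.config t).pebbles v).HasRed → v ∈ S := by
  have h := P.capacity t ht
  have hfin : {v | ((P.config t).pebbles v).HasRed}.Finite := Set.finite_of_encard_le_coe h
  refine ⟨hfin.toFinset, ?_, by simp⟩
  rw [Config.redCount, hfin.encard_eq_coe_toFinset_card] at h
  exact_mod_cast h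

theorem not_hasRed_zero (v : V) : ¬ ((P.config 0).pebbles v).HasRed := by
  rw [P.start]
  by_cases h : G.IsSource v <;> simp [initial, h, Pebbles.HasRed]

theorem marked_mono {s t : ℕ} (hst : s ≤ t) (ht : t ≤ P.length) :
    (P.config s).marked ⊆ (P.config t).marked := by
  induction t, hst using Nat.le_induction with
  | base => exact subset_rfl
  | succ t hst ih => exact (ih (by omega)).trans (P.step t (by omega)).marked_subset

theorem processed {t : ℕ} (ht : t ≤ P.length) :
    ∀ u v, (u, v) ∈ (P.config t).marked → (P.config t).pebbles v = .empty →
      (P.config t).InMarked G v ∧ (P.config t).OutMarked G v := by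
  induction t with
  | zero => simp [P.start, initial]
  | succ t ih => exact (P.step t (by omega)).processed (ih (by omega))

/-- Traces a red pebble back through the interval. The last alternative is impossible for sources;
for a product it means that the computation began afresh inside the interval. -/
theorem hasRed_cases {s t : ℕ} (hst : s ≤ t) (ht : t ≤ P.length) {v : V}
    (hv : ((P.config t).pebbles v).HasRed) :
    ((P.config s).pebbles v).HasRed ∨ (∃ u, s ≤ u ∧ u < t ∧ P.move u = .load v) ∨
      ∃ u, s ≤ u ∧ u < t ∧ (P.config u).pebbles v = .empty ∧ ∃ x, G.Edge x v := by
  induction t, hst using Nat.le_induction with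
  | base => exact .inl hv
  | succ t hst ih =>
    rcases (P.step t (by omega)).hasRed hv with h | h | h
    · rcases ih (by omega) h with h | ⟨u, h₁, h₂, h⟩ | ⟨u, h₁, h₂, h⟩
      · exact .inl h
      · exact .inr (.inl ⟨u, h₁, by omega, h⟩)
      · exact .inr (.inr ⟨u, h₁, by omega, h⟩)
    · exact .inr (.inl ⟨t, hst, by omega, h⟩)
    · exact .inr (.inr ⟨t, hst, by omega, h⟩)

theorem exists_compute {s t : ℕ} (hst : s ≤ t) (ht : t ≤ P.length) {x y : V}
    (hs : (x, y) ∉ (P.config s).marked) (hxy : (x, y) ∈ (P.config t).marked) :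
    ∃ u, s ≤ u ∧ u < t ∧ (x, y) ∉ (P.config u).marked ∧ ((P.config u).pebbles x).HasRed ∧
      (P.config u).InMarked G x ∧ (P.config (u + 1)).pebbles y = .dark := by
  induction t, hst using Nat.le_induction with
  | base => exact absurd hxy hs
  | succ t hst ih =>
    by_cases h : (x, y) ∈ (P.config t).marked
    · obtain ⟨u, h₁, h₂, h⟩ := ih (by omega) h
      exact ⟨u, h₁, by omega, h⟩
    · exact ⟨t, hst, by omega, h, (P.step t (by omega)).of_marked h hxy⟩

/-- Such a node can never receive a pebble again, whereas a sink must end up blue. -/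
theorem not_dead {v : V} (hv : G.IsSink v) {t : ℕ} (ht : t ≤ P.length)
    (h : (P.config t).pebbles v = .empty) (hin : (P.config t).InMarked G v) : False := by
  have key : ∀ u, t ≤ u → u ≤ P.length →
      (P.config u).pebbles v = .empty ∧ (P.config u).InMarked G v := by
    intro u htu
    induction u, htu using Nat.le_induction with
    | base => exact fun _ => ⟨h, hin⟩
    | succ u htu ih =>
      intro hu
      obtain ⟨h₁, h₂⟩ := ih (by omega)
      exact (P.step u (by omega)).dead h₁ h₂
  have h₁ := P.terminal.1 v hv
  rw [(key _ ht le_rfl).1] at h₁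
  simp [Pebbles.HasBlue] at h₁

/-- Deleting the dark red pebble of a sink would leave it dead, so only a save can remove it. -/
theorem dark_cases {v : V} (hv : G.IsSink v) {s t : ℕ} (hst : s ≤ t) (ht : t ≤ P.length)
    (h : (P.config s).pebbles v = .dark) :
    (P.config t).pebbles v = .dark ∨ ∃ u, s ≤ u ∧ u < t ∧ P.move u = .save v := by
  induction t, hst using Nat.le_induction with
  | base => exact .inl h
  | succ t hst ih =>
    rcases ih (by omega) with h | ⟨u, h₁, h₂, h⟩
    · rcases (P.step t (by omega)).dark h with h | h | ⟨h₁, h₂⟩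
      · exact .inl h
      · exact .inr ⟨t, hst, by omega, h⟩
      · exact (P.not_dead hv ht h₁ h₂).elim
    · exact .inr ⟨u, h₁, by omega, h⟩

end Pebbling

end PRBP

/-- The discrete Loomis–Whitney inequality in dimension three. -/
theorem Finset.card_sq_le_of_projections {α β γ : Type*} [DecidableEq α] [DecidableEq β]
    [DecidableEq γ] (X : Finset (α × β × γ)) (A : Finset (α × β)) (B : Finset (β × γ))
    (C : Finset (α × γ)) (hA : ∀ p ∈ X, (p.1, p.2.1) ∈ A) (hB : ∀ p ∈ X, (p.2.1, p.2.2) ∈ B)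
    (hC : ∀ p ∈ X, (p.1, p.2.2) ∈ C) : X.card ^ 2 ≤ A.card * B.card * C.card := by
  let fib : α × γ → Finset (α × β × γ) := fun c => X.filter fun p => (p.1, p.2.2) = c
  have h₁ : X.card = ∑ c ∈ C, (fib c).card := Finset.card_eq_sum_card_fiberwise hC
  -- The sum counts pairs `(p, q)` of points in a common fibre. The first two coordinates of `p` and
  -- the last two of `q` determine the pair, since the fibre fixes the outer coordinates of both.
  have h₂ : ∑ c ∈ C, (fib c).card ^ 2 ≤ A.card * B.card := by
    have : ∑ c ∈ C, (fib c).card ^ 2 = (C.sigma fun c => fib c ×ˢ fib c).card := by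
      simp [Finset.card_sigma, sq]
    rw [this, ← Finset.card_product]
    refine Finset.card_le_card_of_injOn
      (fun x => ((x.2.1.1, x.2.1.2.1), (x.2.2.2.1, x.2.2.2.2))) ?_ ?_
    · rintro ⟨c, p, q⟩ h
      simp only [Finset.coe_sigma, Set.mem_sigma_iff, Finset.mem_coe, Finset.mem_product,
        Finset.mem_filter, fib] at h ⊢
      exact ⟨hA p h.2.1.1, hB q h.2.2.1⟩
    · rintro ⟨⟨a, c⟩, ⟨p₁, p₂, p₃⟩, ⟨q₁, q₂, q₃⟩⟩ h ⟨⟨a', c'⟩, ⟨p₁', p₂', p₃'⟩, ⟨q₁', q₂', q₃'⟩⟩ h' e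
      simp only [Finset.coe_sigma, Set.mem_sigma_iff, Finset.mem_coe, Finset.mem_product,
        Finset.mem_filter, fib, Prod.mk.injEq] at h h' e
      obtain ⟨-, ⟨-, rfl, rfl⟩, -, rfl, rfl⟩ := h
      obtain ⟨-, ⟨-, rfl, rfl⟩, -, rfl, rfl⟩ := h'
      obtain ⟨⟨rfl, rfl⟩, rfl, rfl⟩ := e
      rfl
  calc X.card ^ 2 = (∑ c ∈ C, (fib c).card) ^ 2 := by rw [h₁]
    -- Cauchy–Schwarz.
    _ ≤ C.card * ∑ c ∈ C, (fib c).card ^ 2 := sq_sum_le_card_mul_sum_sq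
    _ ≤ C.card * (A.card * B.card) := Nat.mul_le_mul_left _ h₂
    _ = A.card * B.card * C.card := mul_comm _ _

/-! ### Counting added products in the matrix multiplication DAG. -/

namespace PRBP.Pebbling

variable {m₁ m₂ m₃ r : ℕ} (P : Pebbling (matMulDAG m₁ m₂ m₃) r)

open Classical in
/-- The triples `(i, k, j)` such that the product of `A i k` and `B k j` has been added to `C i j`
before time `t`. -/
noncomputable def added (t : ℕ) : Finset (Fin m₁ × Fin m₂ × Fin m₃) :=
  Finset.univ.filter fun p =>
    (MatMulNode.prod p.1 p.2.1 p.2.2, MatMulNode.out p.1 p.2.2) ∈ (P.config t).marked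

theorem mem_added {t : ℕ} {p : Fin m₁ × Fin m₂ × Fin m₃} : p ∈ P.added t ↔
    (MatMulNode.prod p.1 p.2.1 p.2.2, MatMulNode.out p.1 p.2.2) ∈ (P.config t).marked := by
  simp [added]

theorem added_zero : P.added 0 = ∅ := by
  ext p
  simp [mem_added, P.start, initial]

theorem added_length : P.added P.length = Finset.univ := by
  ext p
  simpa [mem_added] using P.terminal.2 _ _ (MatMulEdge.out p.1 p.2.1 p.2.2)

/-- The number of products added in a time interval that starts with `a` red pebbles and has
cost `q`. -/
theorem card_added_le {s t a q : ℕ} (hst : s ≤ t) (ht : t ≤ P.length)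
    (ha : ∃ S : Finset (MatMulNode m₁ m₂ m₃), S.card ≤ a ∧
      ∀ v, ((P.config s).pebbles v).HasRed → v ∈ S)
    (hq : P.costUpTo t ≤ P.costUpTo s + q) :
    ((P.added t).card : ℝ) ≤ (P.added s).card + (a + q) * (1 + √(r + q)) := by
  classical
  obtain ⟨R, hR, hRmem⟩ := ha
  obtain ⟨R', hR', hRmem'⟩ := P.exists_red ht
  obtain ⟨T, hT, hTmem⟩ := P.exists_transferred hst
  -- `I` looks back to the start of the interval and serves inputs and products; `O` looks ahead to
  -- its end and serves outputs.
  set I := R ∪ T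
  set O := R' ∪ T
  have hI : I.card ≤ a + q := (Finset.card_union_le _ _).trans (by omega)
  have hO : O.card ≤ r + q := (Finset.card_union_le _ _).trans (by omega)
  have source : ∀ v, (∀ u, ¬ MatMulEdge m₁ m₂ m₃ u v) → ∀ u, s ≤ u → u ≤ t →
      ((P.config u).pebbles v).HasRed → v ∈ I := by
    intro v hv u hsu hut hred
    rcases P.hasRed_cases hsu (hut.trans ht) hred with h | ⟨w, h₁, h₂, h⟩ | ⟨w, -, -, -, x, hx⟩
    · exact Finset.mem_union_left _ (hRmem v h)
    · exact Finset.mem_union_right _ (hTmem w h₁ (by omega) v (.inl h))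
    · exact absurd hx (hv x)
  let D : Finset (Fin m₁ × Fin m₂ × Fin m₃) :=
    Finset.univ.filter fun p => MatMulNode.prod p.1 p.2.1 p.2.2 ∈ I
  let A : Finset (Fin m₁ × Fin m₂) := Finset.univ.filter fun p => MatMulNode.left p.1 p.2 ∈ I
  let B : Finset (Fin m₂ × Fin m₃) := Finset.univ.filter fun p => MatMulNode.right p.1 p.2 ∈ I
  let C : Finset (Fin m₁ × Fin m₃) := Finset.univ.filter fun p => MatMulNode.out p.1 p.2 ∈ O
  have hD : D.card ≤ I.card :=
    Finset.card_le_card_of_injOn (fun p => MatMulNode.prod p.1 p.2.1 p.2.2)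
      (fun p hp => by simpa [D] using hp)
      (fun p _ p' _ h => by simp at h; grind)
  have hA : A.card ≤ I.card :=
    Finset.card_le_card_of_injOn (fun p => MatMulNode.left p.1 p.2)
      (fun p hp => by simpa [A] using hp)
      (fun p _ p' _ h => by simp at h; grind)
  have hB : B.card ≤ I.card :=
    Finset.card_le_card_of_injOn (fun p => MatMulNode.right p.1 p.2)
      (fun p hp => by simpa [B] using hp)
      (fun p _ p' _ h => by simp at h; grind)
  have hC : C.card ≤ O.card :=
    Finset.card_le_card_of_injOn (fun p => MatMulNode.out p.1 p.2)
      (fun p hp => by simpa [C] using hp)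
      (fun p _ p' _ h => by simp at h; grind)
  set X := (P.added t \ P.added s) \ D
  have hX : ∀ p ∈ X, (p.1, p.2.1) ∈ A ∧ (p.2.1, p.2.2) ∈ B ∧ (p.1, p.2.2) ∈ C := by
    rintro ⟨i, k, j⟩ hp
    simp only [X, Finset.mem_sdiff, mem_added, D, Finset.mem_filter, Finset.mem_univ,
      true_and] at hp
    obtain ⟨⟨hpt, hps⟩, hpD⟩ := hp
    obtain ⟨w, hsw, hwt, hun, hred, hin, hdark⟩ := P.exists_compute hst ht hps hpt
    have hout : MatMulNode.out i j ∈ O := by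
      have hsink : (matMulDAG m₁ m₂ m₃).IsSink (MatMulNode.out i j) := fun _ h => by cases h
      rcases P.dark_cases hsink (Nat.succ_le_of_lt hwt) ht hdark with h | ⟨u, h₁, h₂, h⟩
      · exact Finset.mem_union_left _ (hRmem' _ (.inr h))
      · exact Finset.mem_union_right _ (hTmem u (by omega) h₂ _ (.inr h))
    rcases P.hasRed_cases hsw (by omega) hred with h | ⟨u, h₁, h₂, h⟩ | ⟨u, h₁, h₂, hemp, -⟩
    · exact absurd (Finset.mem_union_left _ (hRmem _ h)) hpD
    · exact absurd (Finset.mem_union_right _ (hTmem u h₁ (by omega) _ (.inl h))) hpD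
    · have hinput : ∀ x, MatMulEdge m₁ m₂ m₃ x (.prod i k j) →
          (∀ u, ¬ MatMulEdge m₁ m₂ m₃ u x) → x ∈ I := by
        intro x hx hsrc
        -- If an incoming edge were already marked, the empty product node would be fully processed,
        -- so its edge to the output would be marked before time `w`. Hence both incoming edges are
        -- marked within the interval, each requiring a red input.
        have hxu : (x, MatMulNode.prod i k j) ∉ (P.config u).marked := fun hmem =>
          hun (P.marked_mono h₂.le (by omega)
            ((P.processed (by omega) _ _ hmem hemp).2 _ (MatMulEdge.out i k j)))
        obtain ⟨y, hy₁, hy₂, -, hy, -⟩ := P.exists_compute h₂.le (by omega) hxu (hin x hx)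
        exact source x hsrc y (by omega) (by omega) hy
      refine ⟨?_, ?_, by simpa [C] using hout⟩
      · simpa [A] using hinput _ (MatMulEdge.left i k j) fun _ h => by cases h
      · simpa [B] using hinput _ (MatMulEdge.right i k j) fun _ h => by cases h
  have hLW := Finset.card_sq_le_of_projections X A B C (fun p hp => (hX p hp).1)
    (fun p hp => (hX p hp).2.1) fun p hp => (hX p hp).2.2
  have hXcard : (X.card : ℝ) ≤ (a + q) * √(r + q) := by
    refine abs_le_of_sq_le_sq' ?_ (by positivity) |>.2
    rw [mul_pow, Real.sq_sqrt (by positivity)]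
    have : X.card ^ 2 ≤ (a + q) ^ 2 * (r + q) := hLW.trans <| by
      rw [sq]
      exact Nat.mul_le_mul (Nat.mul_le_mul (hA.trans hI) (hB.trans hI)) (hC.trans hO)
    exact_mod_cast this
  have hsub : P.added t ⊆ P.added s ∪ (D ∪ X) := by
    intro p hp
    by_cases h₁ : p ∈ P.added s <;> by_cases h₂ : p ∈ D <;> simp [X, h₁, h₂, hp]
  have hcard : (P.added t).card ≤ (P.added s).card + (D.card + X.card) :=
    (Finset.card_le_card hsub).trans ((Finset.card_union_le _ _).trans
      (Nat.add_le_add_left (Finset.card_union_le _ _) _))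
  have hcard' : ((P.added t).card : ℝ) ≤ (P.added s).card + (D.card + X.card) := by
    exact_mod_cast hcard
  have hD' : (D.card : ℝ) ≤ a + q := by exact_mod_cast hD.trans hI
  linarith

theorem card_added_le_costUpTo (hr : 1 ≤ r) {t : ℕ} (ht : t ≤ P.length) :
    ((P.added t).card : ℝ) ≤ 6 * P.costUpTo t * √r := by
  have hr' : (1 : ℝ) ≤ r := by exact_mod_cast hr
  have hsqrt : 1 ≤ √(r : ℝ) := Real.one_le_sqrt.2 hr'
  have hbound : ∀ q : ℕ, q ≤ r → 1 + √((r : ℝ) + q) ≤ 3 * √r := by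
    intro q hq
    have hq' : (q : ℝ) ≤ r := by exact_mod_cast hq
    have : √((r : ℝ) + q) ≤ 2 * √r := by
      rw [Real.sqrt_le_left (by positivity), mul_pow, Real.sq_sqrt (by positivity)]
      linarith
    linarith
  induction t using Nat.strong_induction_on with
  | _ t ih =>
    by_cases hcost : P.costUpTo t ≤ r
    · have h := P.card_added_le (a := 0) (q := P.costUpTo t) (Nat.zero_le t) ht
        ⟨∅, le_rfl, fun v hv => absurd hv (P.not_hasRed_zero v)⟩ (by omega)
      rw [added_zero] at h
      have h' := mul_le_mul_of_nonneg_left (hbound _ hcost) (Nat.cast_nonneg (P.costUpTo t))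
      have : 0 ≤ (P.costUpTo t : ℝ) * √r := by positivity
      simp only [Finset.card_empty, Nat.cast_zero, zero_add] at h
      linarith
    · obtain ⟨s, hst, hs⟩ := P.exists_costUpTo_eq (Nat.sub_le (P.costUpTo t) r)
      have hlt : s < t := lt_of_le_of_ne hst (by rintro rfl; omega)
      have h := P.card_added_le (q := r) hst ht (P.exists_red (hst.trans ht)) (by omega)
      have h' := mul_le_mul_of_nonneg_left (hbound r le_rfl)
        (by positivity : (0 : ℝ) ≤ (r : ℝ) + r)
      have hs' : (P.costUpTo t : ℝ) = P.costUpTo s + r := by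
        exact_mod_cast (by omega : P.costUpTo t = P.costUpTo s + r)
      have := ih s hlt (hst.trans ht)
      rw [hs']
      linarith

theorem le_cost (hr : 1 ≤ r) : (1 / 6 : ℝ) * (m₁ * m₂ * m₃ / √r) ≤ P.cost := by
  have h := P.card_added_le_costUpTo hr le_rfl
  have hr' : 0 < √(r : ℝ) := Real.sqrt_pos.2 (by exact_mod_cast hr)
  rw [added_length] at h
  simp only [Finset.card_univ, Fintype.card_prod, Fintype.card_fin, Nat.cast_mul] at h
  change _ ≤ 6 * (P.cost : ℝ) * _ at h
  have : (m₁ * m₂ * m₃ / √r : ℝ) ≤ 6 * P.cost := by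
    rw [div_le_iff₀ hr']
    linarith
  linarith

end PRBP.Pebbling

theorem mainTheorem5 :
    ∃ c : ℝ, 0 < c ∧
      ∀ m₁ m₂ m₃ r : ℕ, 1 ≤ m₁ → 1 ≤ m₂ → 1 ≤ m₃ → 1 ≤ r →
        ENNReal.ofReal (c * ((m₁ : ℝ) * (m₂ : ℝ) * (m₃ : ℝ) / Real.sqrt (r : ℝ))) ≤
          ((PRBP.OPT (matMulDAG m₁ m₂ m₃) r : ℕ∞) : ENNReal) := by
  refine ⟨1 / 6, by norm_num, fun m₁ m₂ m₃ r _ _ _ hr => ?_⟩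
  rw [PRBP.OPT, ENat.toENNReal_iInf]
  refine le_iInf fun P => ?_
  rw [ENat.toENNReal_coe, ← ENNReal.ofReal_natCast]
  exact ENNReal.ofReal_le_ofReal (P.le_cost hr)
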